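/- Let $L$ be an essentially bounded real random variable on a probability space, with distribution function $F_L(x)=P(L\le x)$ and quantile function $F_L^{-1}(u)=\inf\{x : F_L(x)\ge u\}$ for $0<u\le 1$; put $F_L^{-1}(0):=\operatorname{ess\,inf}L=\lim_{u\downarrow0}F_L^{-1}(u)$. Let $\sigma:[0,1]\to[0,\infty)$ be a distortion, i.e. a nondecreasing function with $\int_0^1\sigma(u)\,du=1$, and let $$\pi_\sigma(L):=\int_0^1F_L^{-1}(u)\,\sigma(u)\,du,\qquad \mu_\sigma(A):=\sigma(0)\,\delta_0(A)+\int_A(1-\alpha)\,d\sigma(\alpha)\quad(A\subseteq[0,1]\text{ Borel}),$$ where $d\sigma$ is the Lebesgue–Stieltjes measure on $[0,1]$ of $\sigma$, extended to $\mathbb R$ by $\sigma(0)$ on $(-\infty,0)$ and by $\sigma(1)$ on $(1,\infty)$ (its atom at a point is the jump of $\sigma$ there; the point $\alpha=1$ has $\mu_\sigma$-measure $0$). For $h:\mathbb R\to\mathbb R$ let $h^*(y):=\sup_{x\in\mathbb R}\,(xy-h(x))\in(-\infty,+\infty]$. **Theorem.** The integral defining $\pi_\sigma(L)$ converges, and $$\pi_\sigma(L)=\inf_h\Big\{\mathbb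 E\,h(L)+\int_0^1h^*(\sigma(p))\,dp\Big\},$$ where the infimum is over all Borel measurable functions $h:\mathbb R\to\mathbb R$. Here integrals are extended-real valued, equal to $+\infty$ whenever the integral of the positive part is infinite, and the sum is $+\infty$ whenever one of its two terms is $+\infty$. Moreover, the function $$h_\sigma(y):=\int_{[0,1]}\Big[F_L^{-1}(\alpha)+\frac{(y-F_L^{-1}(\alpha))_+}{1-\alpha}\Big]\,\mu_\sigma(d\alpha),\qquad y\in\mathbb R,$$ is well defined (the integrand is $\mu_\sigma$-integrable for every $y$), measurable and convex; $h_\sigma(L)$ is integrable, and $$\mathbb E\,h_\sigma(L)=\pi_\sigma(L),\qquad \int_0^1h_\sigma^*(\sigma(u))\,du=0.$$ In particular the infimum is attained at $h_\sigma$. -/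

import Mathlib

open MeasureTheory Set

noncomputable section

namespace DistortedPremium

/-- A distortion: a nonnegative, nondecreasing function `σ : [0,1] → ℝ` with `∫₀¹ σ(u) du = 1`.
The values of `toFun` outside `[0,1]` play no role. -/
structure Distortion where
  toFun : ℝ → ℝ
  nonneg : ∀ u ∈ Icc (0 : ℝ) 1, 0 ≤ toFun u
  monotoneOn : MonotoneOn toFun (Icc 0 1)
  integral_eq_one : ∫ u in (0 : ℝ)..1, toFun u = 1

instance : CoeFun Distortion (fun _ => ℝ → ℝ) := ⟨Distortion.toFun⟩

/-- The extension of `σ` to the real line that is constant on `(-∞,0]` and on `[1,∞)`. -/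
def Distortion.extend (σ : Distortion) (x : ℝ) : ℝ := σ (max 0 (min 1 x))

theorem Distortion.monotone_extend (σ : Distortion) : Monotone σ.extend := fun _ _ hxy =>
  σ.monotoneOn ⟨le_max_left _ _, max_le zero_le_one (min_le_left _ _)⟩
    ⟨le_max_left _ _, max_le zero_le_one (min_le_left _ _)⟩
    (max_le_max le_rfl (min_le_min le_rfl hxy))

/-- The Lebesgue–Stieltjes measure `dσ`; it is carried by `[0,1]`, and its atom at a point is the
jump of `σ` there (only the one-sided jump at the endpoints `0` and `1`). -/
def Distortion.stieltjesMeasure (σ : Distortion) : Measure ℝ :=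
  σ.monotone_extend.stieltjesFunction.measure

/-- The measure `μ_σ(A) = σ(0) δ₀(A) + ∫_A (1 - α) dσ(α)`, carried by `[0,1]`. -/
def Distortion.mu (σ : Distortion) : Measure ℝ :=
  ENNReal.ofReal (σ 0) • Measure.dirac 0 +
    σ.stieltjesMeasure.withDensity (fun α => ENNReal.ofReal (1 - α))

section Loss

variable {Ω : Type*} [MeasurableSpace Ω]

/-- The distribution function `F_L(x) = P(L ≤ x)`. -/
def distFun (P : Measure Ω) (L : Ω → ℝ) (x : ℝ) : ℝ := P.real {ω | L ω ≤ x}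

/-- The quantile `F_L⁻¹(u) = inf {x : F_L(x) ≥ u}` for `0 < u ≤ 1`. The clause `0 < F_L(x)` matters
only at `u = 0`, where it gives `F_L⁻¹(0) = ess inf L` (the right limit at `0`) in place of `-∞`. -/
def quantile (P : Measure Ω) (L : Ω → ℝ) (u : ℝ) : ℝ :=
  sInf {x | u ≤ distFun P L x ∧ 0 < distFun P L x}

theorem quantile_of_pos (P : Measure Ω) (L : Ω → ℝ) {u : ℝ} (hu : 0 < u) :
    quantile P L u = sInf {x | u ≤ distFun P L x} := by
  unfold quantile
  congr 1
  ext x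
  exact ⟨fun h => h.1, fun h => ⟨h, lt_of_lt_of_le hu h⟩⟩

/-- The distorted premium `π_σ(L) = ∫₀¹ F_L⁻¹(u) σ(u) du`. -/
def premium (P : Measure Ω) (σ : Distortion) (L : Ω → ℝ) : ℝ :=
  ∫ u in (0 : ℝ)..1, quantile P L u * σ u

/-- The integral of an extended-real-valued function, `∫ f⁺ - ∫ f⁻`, with the convention of
minimization problems that it is `+∞` whenever `∫ f⁺ = +∞`. -/
def extIntegral (μ : Measure Ω) (f : Ω → EReal) : EReal :=
  open Classical in
  if ∫⁻ x, (f x).toENNReal ∂μ = ⊤ then ⊤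
  else ((∫⁻ x, (f x).toENNReal ∂μ : ENNReal) : EReal) -
    ((∫⁻ x, (-f x).toENNReal ∂μ : ENNReal) : EReal)

/-- The convex conjugate `h*(y) = sup_x (x y - h(x))`, with values in the extended reals. -/
def conjugate (h : ℝ → ℝ) (y : ℝ) : EReal := ⨆ x : ℝ, ((x * y - h x : ℝ) : EReal)

/-- `∫₀¹ h*(σ(p)) dp`. -/
def conjugateTerm (σ : Distortion) (h : ℝ → ℝ) : EReal :=
  extIntegral (volume.restrict (Icc (0 : ℝ) 1)) (fun p => conjugate h (σ p))

/-- `E h(L)`, as an extended real number. -/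
def expectationTerm (P : Measure Ω) (L : Ω → ℝ) (h : ℝ → ℝ) : EReal :=
  extIntegral P (fun ω => ((h (L ω) : ℝ) : EReal))

/-- The objective `E h(L) + ∫₀¹ h*(σ(p)) dp`, which is `+∞` as soon as one of the terms is (the
addition of `EReal` would give `(+∞) + (-∞) = -∞`). -/
def objective (P : Measure Ω) (σ : Distortion) (L : Ω → ℝ) (h : ℝ → ℝ) : EReal :=
  open Classical in
  if expectationTerm P L h = ⊤ ∨ conjugateTerm σ h = ⊤ then ⊤
  else expectationTerm P L h + conjugateTerm σ h

/-- The integrand `F_L⁻¹(α) + (y - F_L⁻¹(α))₊ / (1 - α)`. -/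
def optimalIntegrand (P : Measure Ω) (L : Ω → ℝ) (y α : ℝ) : ℝ :=
  quantile P L α + max (y - quantile P L α) 0 / (1 - α)

/-- `h_σ(y) = ∫ [F_L⁻¹(α) + (y - F_L⁻¹(α))₊ / (1 - α)] μ_σ(dα)`. -/
def optimal (P : Measure Ω) (σ : Distortion) (L : Ω → ℝ) (y : ℝ) : ℝ :=
  ∫ α, optimalIntegrand P L y α ∂σ.mu

end Loss

end DistortedPremium

end

/-!
Let `Q` be the quantile function of `L` and `ν = σ(0) δ₀ + dσ` on `[0,1)`, so that
`μ_σ(dα) = (1 - α) ν(dα)`. Under Lebesgue measure on `[0,1]` the function `Q` has the law of `L`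
(`map_quantileExt`), hence `E h(L) = ∫₀¹ h(Q(u)) du`.

The premium is a lower bound because Young's inequality `Q(u) σ(u) ≤ h(Q(u)) + h*(σ(u))` can be
integrated over `[0,1]` (`premium_le_objective`). When neither term of the objective is `+∞`, the
inequality also bounds the negative part of each summand by the positive part of the other
(`integrable_of_le_add`), so both are integrable and no indeterminate form occurs.

The bound is attained because Young's inequality is an equality along `Q` for `h = h_σ`. The factor
`1 - α` cancels, and `h_σ(y) = ∫ [(1 - α) Q(α) + (y - Q(α))₊] ν(dα)` (`optimal_eq_callMixture`) is
an integral of a bounded function against a finite measure. At `y = Q(u)` with `u < 1`, every number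
between `ν(-∞,u)` and `ν(-∞,u]` is a subgradient of `h_σ` (`callMixture_add_le`), and `σ(u)` is
such a number; therefore `h_σ*(σ(u)) = Q(u) σ(u) - h_σ(Q(u))`. Finally, Fubini's theorem gives
`∫₀¹ h_σ(Q(u)) du = ∫₀¹ Q(u) ν(-∞,u] du` (`integral_callMixture_comp`), and `ν(-∞,u] = σ(u)`
except at the countably many atoms of `ν`, so this is `π_σ(L)`.
-/

namespace DistortedPremium

open Filter Topology

/-! ### Extended-real integrals -/

section ExtIntegral

variable {α : Type*} [MeasurableSpace α] {μ : Measure α}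

theorem extIntegral_congr {f g : α → EReal} (h : f =ᵐ[μ] g) :
    extIntegral μ f = extIntegral μ g := by
  unfold extIntegral
  rw [lintegral_congr_ae (f := fun x => (f x).toENNReal) (h.fun_comp EReal.toENNReal),
    lintegral_congr_ae (f := fun x => (-f x).toENNReal) (h.fun_comp fun x => (-x).toENNReal)]
  rfl

theorem extIntegral_coe {f : α → ℝ} (hf : Integrable f μ) :
    extIntegral μ (fun x => (f x : EReal)) = ((∫ x, f x ∂μ : ℝ) : EReal) := by
  have hpos : ∫⁻ x, ENNReal.ofReal (f x) ∂μ ≠ ⊤ := hf.lintegral_lt_top.ne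
  have hneg : ∫⁻ x, ENNReal.ofReal (-f x) ∂μ ≠ ⊤ := hf.neg.lintegral_lt_top.ne
  have hneg' : ∀ x, (-(f x : EReal)).toENNReal = ENNReal.ofReal (-f x) := fun x => by
    rw [← EReal.coe_neg, EReal.real_coe_toENNReal]
  simp only [extIntegral, EReal.real_coe_toENNReal, hneg', if_neg hpos]
  rw [integral_eq_lintegral_pos_part_sub_lintegral_neg_part hf, EReal.coe_sub,
    EReal.coe_ennreal_toReal hpos, EReal.coe_ennreal_toReal hneg]

theorem lintegral_toENNReal_ne_top {f : α → EReal} (h : extIntegral μ f ≠ ⊤) :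
    ∫⁻ x, (f x).toENNReal ∂μ ≠ ⊤ := fun h' => h (by simp [extIntegral, h'])

/-- The negative part of `f` is dominated by the positive part of `g` and by `|k|`. -/
theorem integrable_of_le_add {f g k : α → ℝ} (hk : Integrable k μ) (hf : AEMeasurable f μ)
    (hf' : ∫⁻ x, ENNReal.ofReal (f x) ∂μ ≠ ⊤) (hg : AEMeasurable g μ)
    (hg' : ∫⁻ x, ENNReal.ofReal (g x) ∂μ ≠ ⊤) (h : ∀ᵐ x ∂μ, k x ≤ f x + g x) :
    Integrable f μ := by
  refine ⟨hf.aestronglyMeasurable, ?_⟩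
  have hk' := hk.hasFiniteIntegral
  unfold HasFiniteIntegral at hk' ⊢
  calc ∫⁻ x, ‖f x‖ₑ ∂μ
      ≤ ∫⁻ x, (ENNReal.ofReal (f x) + ENNReal.ofReal (g x) + ‖k x‖ₑ) ∂μ := by
        refine lintegral_mono_ae (h.mono fun x hx => ?_)
        have hmax : ∀ r : ℝ, ENNReal.ofReal r = ENNReal.ofReal (max r 0) := fun r => by
          rcases le_total r 0 with hr | hr
          · rw [max_eq_right hr, ENNReal.ofReal_of_nonpos hr, ENNReal.ofReal_zero]
          · rw [max_eq_left hr]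
        rw [Real.enorm_eq_ofReal_abs, Real.enorm_eq_ofReal_abs, hmax (f x), hmax (g x),
          ← ENNReal.ofReal_add (le_max_right _ _) (le_max_right _ _),
          ← ENNReal.ofReal_add (by positivity) (abs_nonneg _)]
        refine ENNReal.ofReal_le_ofReal (abs_le'.2 ⟨?_, ?_⟩)
        · linarith [le_max_left (f x) 0, le_max_right (g x) 0, abs_nonneg (k x)]
        · linarith [le_max_right (f x) 0, le_max_left (g x) 0, neg_abs_le (k x)]
    _ < ⊤ := by
        rw [lintegral_add_left' (by fun_prop), lintegral_add_left' (by fun_prop)]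
        exact ENNReal.add_lt_top.2 ⟨ENNReal.add_lt_top.2 ⟨hf'.lt_top, hg'.lt_top⟩, hk'⟩

/-- A pointwise lower bound by an integrable function passes to extended-real integrals, provided
neither of them is `+∞`. -/
theorem integral_le_extIntegral_add {f k : α → ℝ} {g : α → EReal} (hk : Integrable k μ)
    (hf : AEMeasurable f μ) (hg : AEMeasurable g μ) (hbot : ∀ x, g x ≠ ⊥)
    (hf' : extIntegral μ (fun x => (f x : EReal)) ≠ ⊤) (hg' : extIntegral μ g ≠ ⊤)
    (h : ∀ᵐ x ∂μ, (k x : EReal) ≤ (f x : EReal) + g x) :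
    ((∫ x, k x ∂μ : ℝ) : EReal) ≤ extIntegral μ (fun x => (f x : EReal)) + extIntegral μ g := by
  have hgpos := lintegral_toENNReal_ne_top hg'
  have hfpos := lintegral_toENNReal_ne_top hf'
  have hreal : ∀ᵐ x ∂μ, g x = (((g x).toReal : ℝ) : EReal) := by
    filter_upwards [ae_lt_top' (by fun_prop) hgpos] with x hx
    exact (EReal.coe_toReal (fun hx' => by simp [hx'] at hx) (hbot x)).symm
  have hgm : AEMeasurable (fun x => (g x).toReal) μ := hg.ereal_toReal
  have hle : ∀ᵐ x ∂μ, k x ≤ f x + (g x).toReal := by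
    filter_upwards [h, hreal] with x hx hx'
    rw [hx', ← EReal.coe_add, EReal.coe_le_coe_iff] at hx
    exact hx
  have hgpos' : ∫⁻ x, ENNReal.ofReal (g x).toReal ∂μ ≠ ⊤ := by
    rwa [lintegral_congr_ae (g := fun x => (g x).toENNReal)]
    filter_upwards [hreal] with x hx
    conv_rhs => rw [hx]
    rfl
  have hfi := integrable_of_le_add hk hf hfpos hgm hgpos' hle
  have hgi := integrable_of_le_add hk hgm hgpos' hf hfpos (hle.mono fun x hx => by linarith)
  rw [extIntegral_congr hreal, extIntegral_coe hfi, extIntegral_coe hgi, ← EReal.coe_add,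
    EReal.coe_le_coe_iff, ← integral_add hfi hgi]
  exact integral_mono_ae hk (hfi.add hgi) hle

end ExtIntegral

/-! ### The convex conjugate -/

theorem le_conjugate (h : ℝ → ℝ) (x y : ℝ) : ((x * y - h x : ℝ) : EReal) ≤ conjugate h y :=
  le_iSup (fun x : ℝ => ((x * y - h x : ℝ) : EReal)) x

theorem conjugate_ne_bot (h : ℝ → ℝ) (y : ℝ) : conjugate h y ≠ ⊥ :=
  ((EReal.bot_lt_coe _).trans_le (le_conjugate h 0 y)).ne'

theorem measurable_conjugate (h : ℝ → ℝ) : Measurable (conjugate h) := by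
  refine (lowerSemicontinuous_iSup fun x => ?_).measurable
  exact (continuous_coe_real_ereal.comp (by fun_prop)).lowerSemicontinuous

/-- A subgradient `y` of `h` at `a` turns the supremum in the conjugate into a maximum. -/
theorem conjugate_eq_of_subgradient {h : ℝ → ℝ} {a y : ℝ}
    (hy : ∀ x, h a + (x - a) * y ≤ h x) : conjugate h y = ((a * y - h a : ℝ) : EReal) := by
  refine le_antisymm (iSup_le fun x => ?_) (le_conjugate h a y)
  rw [EReal.coe_le_coe_iff]
  linarith [hy x]

theorem coe_mul_le_add_conjugate (h : ℝ → ℝ) (x y : ℝ) :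
    ((x * y : ℝ) : EReal) ≤ (h x : EReal) + conjugate h y := by
  have := add_le_add_right (le_conjugate h x y) (h x : EReal)
  rwa [← EReal.coe_add, add_sub_cancel] at this

/-! ### Quantiles -/

section Quantile

variable {Ω : Type*} [MeasurableSpace Ω] {P : Measure Ω} {L : Ω → ℝ}

theorem distFun_eq_cdf [IsProbabilityMeasure P] (hL : AEMeasurable L P) (x : ℝ) :
    distFun P L x = ProbabilityTheory.cdf (P.map L) x := by
  have := Measure.isProbabilityMeasure_map hL
  rw [ProbabilityTheory.cdf_eq_real, distFun, measureReal_def, measureReal_def,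
    Measure.map_apply_of_aemeasurable hL measurableSet_Iic]
  rfl

theorem exists_ae_abs_le (hL : MemLp L ⊤ P) : ∃ M, ∀ᵐ ω ∂P, |L ω| ≤ M := by
  refine ⟨(eLpNorm L ⊤ P).toReal, ?_⟩
  filter_upwards [ae_le_eLpNormEssSup (f := L) (μ := P)] with ω hω
  rw [← eLpNorm_exponent_top] at hω
  rw [← Real.norm_eq_abs, ← toReal_enorm]
  exact ENNReal.toReal_mono hL.2.ne hω

theorem le_of_distFun_pos {M x : ℝ} (hM : ∀ᵐ ω ∂P, |L ω| ≤ M) (hx : 0 < distFun P L x) :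
    -M ≤ x := by
  by_contra! h
  refine hx.ne' ?_
  rw [distFun, measureReal_def, measure_mono_null _ hM]
  · rfl
  · intro ω hω hω'
    have h1 : L ω ≤ x := hω
    have h2 : |L ω| ≤ M := hω'
    linarith [(abs_le.1 h2).1]

theorem distFun_eq_one [IsProbabilityMeasure P] {M : ℝ} (hM : ∀ᵐ ω ∂P, |L ω| ≤ M) :
    distFun P L M = 1 := by
  have : {ω | L ω ≤ M} =ᵐ[P] univ := by
    filter_upwards [hM] with ω hω
    exact eq_true ((le_abs_self _).trans hω)
  rw [distFun, measureReal_congr this, probReal_univ]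

theorem bddBelow_quantile_set {M : ℝ} (hM : ∀ᵐ ω ∂P, |L ω| ≤ M) (u : ℝ) :
    BddBelow {x | u ≤ distFun P L x ∧ 0 < distFun P L x} :=
  ⟨-M, fun _ hx => le_of_distFun_pos hM hx.2⟩

theorem mem_quantile_set [IsProbabilityMeasure P] {M : ℝ} (hM : ∀ᵐ ω ∂P, |L ω| ≤ M) {u : ℝ}
    (hu : u ≤ 1) : M ∈ {x | u ≤ distFun P L x ∧ 0 < distFun P L x} := by
  simp [distFun_eq_one hM, hu]

theorem monotoneOn_quantile [IsProbabilityMeasure P] (hL : MemLp L ⊤ P) :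
    MonotoneOn (quantile P L) (Iic 1) := by
  obtain ⟨M, hM⟩ := exists_ae_abs_le hL
  exact fun u _ v hv huv => csInf_le_csInf (bddBelow_quantile_set hM u) ⟨M, mem_quantile_set hM hv⟩
    fun x hx => ⟨huv.trans hx.1, hx.2⟩

theorem abs_quantile_le [IsProbabilityMeasure P] {M : ℝ} (hM : ∀ᵐ ω ∂P, |L ω| ≤ M) {u : ℝ}
    (hu : u ≤ 1) : |quantile P L u| ≤ M :=
  abs_le.2 ⟨le_csInf ⟨M, mem_quantile_set hM hu⟩ fun _ hx => le_of_distFun_pos hM hx.2,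
    csInf_le (bddBelow_quantile_set hM u) (mem_quantile_set hM hu)⟩

/-- The Galois connection between quantile and distribution function; it rests on the right
continuity of the latter. -/
theorem quantile_le_iff [IsProbabilityMeasure P] (hL : MemLp L ⊤ P) {u x : ℝ} (hu : u ∈ Ioc 0 1) :
    quantile P L u ≤ x ↔ u ≤ distFun P L x := by
  obtain ⟨M, hM⟩ := exists_ae_abs_le hL
  have hcdf := distFun_eq_cdf hL.1.aemeasurable (P := P)
  refine ⟨fun h => ?_, fun h => csInf_le (bddBelow_quantile_set hM u) ⟨h, hu.1.trans_le h⟩⟩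
  have hgt : ∀ y > x, u ≤ distFun P L y := fun y hy => by
    obtain ⟨s, hs, hsy⟩ := exists_lt_of_csInf_lt ⟨M, mem_quantile_set hM hu.2⟩ (h.trans_lt hy)
    refine hs.1.trans ?_
    rw [hcdf, hcdf]
    exact ProbabilityTheory.monotone_cdf _ hsy.le
  rw [hcdf]
  have hcont := ((ProbabilityTheory.cdf (P.map L)).right_continuous x).mono Ioi_subset_Ici_self
  refine ge_of_tendsto hcont ?_
  filter_upwards [self_mem_nhdsWithin] with y hy
  rw [← hcdf]
  exact hgt y hy

/-- The quantile function on `[0,1]`, extended by constants to a monotone function on the line. -/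
noncomputable def quantileExt (P : Measure Ω) (L : Ω → ℝ) (u : ℝ) : ℝ :=
  quantile P L (max 0 (min 1 u))

theorem quantileExt_eq {u : ℝ} (hu : u ∈ Icc (0 : ℝ) 1) : quantileExt P L u = quantile P L u := by
  rw [quantileExt, min_eq_right hu.2, max_eq_right hu.1]

theorem monotone_quantileExt [IsProbabilityMeasure P] (hL : MemLp L ⊤ P) :
    Monotone (quantileExt P L) := fun _ _ huv =>
  monotoneOn_quantile hL (mem_Iic.2 (max_le zero_le_one (min_le_left _ _)))
    (mem_Iic.2 (max_le zero_le_one (min_le_left _ _))) (max_le_max le_rfl (min_le_min le_rfl huv))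

theorem abs_quantileExt_le [IsProbabilityMeasure P] {M : ℝ} (hM : ∀ᵐ ω ∂P, |L ω| ≤ M) (u : ℝ) :
    |quantileExt P L u| ≤ M :=
  abs_quantile_le hM (max_le zero_le_one (min_le_left _ _))

/-- Quantile transform: the quantile function of `L` at a uniform variable has the law of `L`. -/
theorem map_quantileExt [IsProbabilityMeasure P] (hL : MemLp L ⊤ P) :
    (volume.restrict (Icc (0 : ℝ) 1)).map (quantileExt P L) = P.map L := by
  have hm := (monotone_quantileExt hL).measurable
  have := Measure.isProbabilityMeasure_map hL.1.aemeasurable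
  have : IsFiniteMeasure ((volume.restrict (Icc (0 : ℝ) 1)).map (quantileExt P L)) :=
    Measure.isFiniteMeasure_map _ _
  refine Measure.ext_of_Iic _ _ fun x => ?_
  rw [← ProbabilityTheory.ofReal_cdf (P.map L), ← distFun_eq_cdf hL.1.aemeasurable,
    Measure.map_apply hm measurableSet_Iic, ← restrict_Ioc_eq_restrict_Icc,
    Measure.restrict_apply (hm measurableSet_Iic)]
  have hle : distFun P L x ≤ 1 := measureReal_le_one
  have : quantileExt P L ⁻¹' Iic x ∩ Ioc 0 1 = Ioc 0 (distFun P L x) := by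
    ext u
    refine ⟨fun ⟨h, hu⟩ => ⟨hu.1, ?_⟩, fun h => ?_⟩
    · rwa [mem_preimage, mem_Iic, quantileExt_eq (Ioc_subset_Icc_self hu),
        quantile_le_iff hL hu] at h
    · have hu : u ∈ Ioc (0 : ℝ) 1 := ⟨h.1, h.2.trans hle⟩
      refine ⟨?_, hu⟩
      rw [mem_preimage, mem_Iic, quantileExt_eq (Ioc_subset_Icc_self hu), quantile_le_iff hL hu]
      exact h.2
  rw [this, Real.volume_Ioc, sub_zero]

end Quantile

/-! ### Mixtures of call functions -/

section CallMixture

/-- The function `y ↦ ∫ [(1 - α) Q(α) + (y - Q(α))₊] ν(dα)`, a mixture of the call payoffs with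
strikes `Q(α)`. -/
noncomputable def callMixture (ν : Measure ℝ) (Q : ℝ → ℝ) (y : ℝ) : ℝ :=
  ∫ α, ((1 - α) * Q α + max (y - Q α) 0) ∂ν

variable {ν : Measure ℝ} [IsFiniteMeasure ν] {Q : ℝ → ℝ} {M : ℝ}

/-- The bound is uniform in `α`, and in `y` over bounded sets. The latter is what Fubini's theorem
needs when `y` runs through the values of `Q`. -/
theorem abs_callMixture_integrand_le (hM : ∀ u, |Q u| ≤ M) {α : ℝ} (hα : α ∈ Ico (0 : ℝ) 1)
    (y : ℝ) : |(1 - α) * Q α + max (y - Q α) 0| ≤ 2 * M + |y| := by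
  have h1 : |(1 - α) * Q α| ≤ 1 * M := by
    rw [abs_mul]
    exact mul_le_mul (abs_le.2 ⟨by linarith [hα.2], by linarith [hα.1]⟩) (hM α) (abs_nonneg _)
      zero_le_one
  have h2 : |max (y - Q α) 0| ≤ |y| + M := by
    rw [abs_of_nonneg (le_max_right _ _)]
    exact max_le (by linarith [le_abs_self y, neg_le_of_abs_le (hM α)])
      (add_nonneg (abs_nonneg _) ((abs_nonneg _).trans (hM α)))
  linarith [abs_add_le ((1 - α) * Q α) (max (y - Q α) 0)]

theorem integrable_callMixture (hν : ∀ᵐ α ∂ν, α ∈ Ico (0 : ℝ) 1) (hQ : Monotone Q)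
    (hM : ∀ u, |Q u| ≤ M) (y : ℝ) :
    Integrable (fun α => (1 - α) * Q α + max (y - Q α) 0) ν := by
  have := hQ.measurable
  refine Integrable.of_bound (C := 2 * M + |y|) (by fun_prop) ?_
  filter_upwards [hν] with α hα
  exact abs_callMixture_integrand_le hM hα y

theorem convexOn_callMixture (hν : ∀ᵐ α ∂ν, α ∈ Ico (0 : ℝ) 1) (hQ : Monotone Q)
    (hM : ∀ u, |Q u| ≤ M) : ConvexOn ℝ univ (callMixture ν Q) := by
  refine ⟨convex_univ, fun x _ y _ a b ha hb hab => ?_⟩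
  have hx := (integrable_callMixture hν hQ hM x).const_mul a
  have hy := (integrable_callMixture hν hQ hM y).const_mul b
  simp only [callMixture, smul_eq_mul]
  rw [← integral_const_mul, ← integral_const_mul, ← integral_add hx hy]
  refine integral_mono (integrable_callMixture hν hQ hM _) (hx.add hy) fun α => ?_
  have h1 := mul_le_mul_of_nonneg_left (le_max_left (x - Q α) 0) ha
  have h2 := mul_le_mul_of_nonneg_left (le_max_left (y - Q α) 0) hb
  have h3 := mul_le_mul_of_nonneg_left (le_max_right (x - Q α) 0) ha
  have h4 := mul_le_mul_of_nonneg_left (le_max_right (y - Q α) 0) hb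
  have hb' : b = 1 - a := by linarith
  subst hb'
  have : max (a * x + (1 - a) * y - Q α) 0
      ≤ a * max (x - Q α) 0 + (1 - a) * max (y - Q α) 0 :=
    max_le (by linarith) (by linarith)
  simp only
  linarith

theorem monotone_callMixture (hν : ∀ᵐ α ∂ν, α ∈ Ico (0 : ℝ) 1) (hQ : Monotone Q)
    (hM : ∀ u, |Q u| ≤ M) : Monotone (callMixture ν Q) := fun x y hxy => by
  refine integral_mono (integrable_callMixture hν hQ hM _) (integrable_callMixture hν hQ hM _)
    fun α => ?_
  have : max (x - Q α) 0 ≤ max (y - Q α) 0 := max_le_max (by linarith) le_rfl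
  simpa using this

/-- The one-sided derivatives of the mixture at `Q u` are at most `ν (-∞,u)` and at least
`ν (-∞,u]`, so every number in between is a subgradient there. -/
theorem callMixture_add_le (hν : ∀ᵐ α ∂ν, α ∈ Ico (0 : ℝ) 1) (hQ : Monotone Q)
    (hM : ∀ u, |Q u| ≤ M) {u s : ℝ} (hs : ν.real (Iio u) ≤ s) (hs' : s ≤ ν.real (Iic u)) (x : ℝ) :
    callMixture ν Q (Q u) + (x - Q u) * s ≤ callMixture ν Q x := by
  have hx := integrable_callMixture hν hQ hM x
  have hu := integrable_callMixture hν hQ hM (Q u)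
  rcases le_total (Q u) x with h | h
  · have hi : Integrable ((Iic u).indicator fun _ => x - Q u) ν :=
      (integrable_const _).indicator measurableSet_Iic
    calc callMixture ν Q (Q u) + (x - Q u) * s
        ≤ callMixture ν Q (Q u) + (x - Q u) * ν.real (Iic u) := by
          gcongr
      _ = ∫ α, ((1 - α) * Q α + max (Q u - Q α) 0 + (Iic u).indicator (fun _ => x - Q u) α) ∂ν := by
          rw [integral_add hu hi, integral_indicator_const _ measurableSet_Iic, smul_eq_mul,
            mul_comm, callMixture]
      _ ≤ callMixture ν Q x := by
          refine integral_mono (hu.add hi) hx fun α => ?_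
          by_cases hα : α ≤ u
          -- For `α ≤ u` both positive parts are active and the difference is exactly `x - Q u`.
          · have := hQ hα
            rw [indicator_of_mem (mem_Iic.2 hα)]
            simp only
            rw [max_eq_left (by linarith), max_eq_left (by linarith)]
            linarith
          · rw [indicator_of_notMem (by simpa using hα)]
            have : max (Q u - Q α) 0 ≤ max (x - Q α) 0 := max_le_max (by linarith) le_rfl
            simpa using this
  · have hi : Integrable ((Iio u).indicator fun _ => x - Q u) ν :=
      (integrable_const _).indicator measurableSet_Iio
    calc callMixture ν Q (Q u) + (x - Q u) * s
        ≤ callMixture ν Q (Q u) + (x - Q u) * ν.real (Iio u) := by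
          linarith [mul_le_mul_of_nonpos_left hs (sub_nonpos.2 h)]
      _ = ∫ α, ((1 - α) * Q α + max (Q u - Q α) 0 + (Iio u).indicator (fun _ => x - Q u) α) ∂ν := by
          rw [integral_add hu hi, integral_indicator_const _ measurableSet_Iio, smul_eq_mul,
            mul_comm, callMixture]
      _ ≤ callMixture ν Q x := by
          refine integral_mono (hu.add hi) hx fun α => ?_
          by_cases hα : α < u
          -- Decreasing the argument to `x` lowers the positive part by at most `Q u - x`.
          · have := hQ hα.le
            rw [indicator_of_mem (mem_Iio.2 hα)]
            simp only
            rw [max_eq_left (a := Q u - Q α) (by linarith)]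
            linarith [le_max_left (x - Q α) 0]
          · rw [indicator_of_notMem (by simpa using hα)]
            have := hQ (not_lt.1 hα)
            simp only
            rw [max_eq_right (a := Q u - Q α) (by linarith)]
            linarith [le_max_right (x - Q α) 0]

theorem integrable_callMixture_prod (hν : ∀ᵐ α ∂ν, α ∈ Ico (0 : ℝ) 1) (hQ : Monotone Q)
    (hM : ∀ u, |Q u| ≤ M) :
    Integrable (Function.uncurry fun u α => (1 - α) * Q α + max (Q u - Q α) 0)
      ((volume.restrict (Icc (0 : ℝ) 1)).prod ν) := by
  have := hQ.measurable
  refine Integrable.of_bound (C := 2 * M + M) (Measurable.aestronglyMeasurable ?_) ?_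
  · unfold Function.uncurry
    fun_prop
  · have hae : ∀ᵐ p ∂(volume.restrict (Icc (0 : ℝ) 1)).prod ν, p.2 ∈ Ico (0 : ℝ) 1 :=
      Measure.quasiMeasurePreserving_snd.ae hν
    filter_upwards [hae] with p hp
    exact (abs_callMixture_integrand_le hM hp (Q p.1)).trans (by linarith [hM p.1])

theorem integrable_callMixture_comp (hν : ∀ᵐ α ∂ν, α ∈ Ico (0 : ℝ) 1) (hQ : Monotone Q)
    (hM : ∀ u, |Q u| ≤ M) :
    Integrable (fun u => callMixture ν Q (Q u)) (volume.restrict (Icc (0 : ℝ) 1)) :=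
  (integrable_callMixture_prod hν hQ hM).integral_prod_left

/-- For fixed `α`, the integrand `(1 - α) Q(α) + (Q(u) - Q(α))₊` has the same integral over
`u ∈ [0,1]` as `Q(u) 1{α ≤ u}`; Fubini's theorem does the rest. -/
theorem integral_callMixture_comp (hν : ∀ᵐ α ∂ν, α ∈ Ico (0 : ℝ) 1) (hQ : Monotone Q)
    (hM : ∀ u, |Q u| ≤ M) :
    ∫ u in Icc (0 : ℝ) 1, callMixture ν Q (Q u) = ∫ u in Icc (0 : ℝ) 1, Q u * ν.real (Iic u) := by
  have hQm := hQ.measurable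
  have hset : MeasurableSet {p : ℝ × ℝ | p.2 ≤ p.1} :=
    measurableSet_le measurable_snd measurable_fst
  have hprod : Integrable (Function.uncurry fun u α => (Iic u).indicator (fun _ => Q u) α)
      ((volume.restrict (Icc (0 : ℝ) 1)).prod ν) := by
    have heq : (Function.uncurry fun u α => (Iic u).indicator (fun _ => Q u) α)
        = {p : ℝ × ℝ | p.2 ≤ p.1}.indicator fun p => Q p.1 := by
      ext p
      simp [Function.uncurry, indicator]
    rw [heq]
    refine Integrable.indicator ?_ hset
    exact Integrable.of_bound (C := M) (hQm.comp measurable_fst).aestronglyMeasurable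
      (Eventually.of_forall fun p => hM p.1)
  have hrhs : ∀ u, Q u * ν.real (Iic u) = ∫ α, (Iic u).indicator (fun _ => Q u) α ∂ν := fun u => by
    rw [integral_indicator_const _ measurableSet_Iic, smul_eq_mul, mul_comm]
  simp only [hrhs, callMixture]
  rw [integral_integral_swap (integrable_callMixture_prod hν hQ hM), integral_integral_swap hprod]
  refine integral_congr_ae ?_
  filter_upwards [hν] with α hα
  -- The two correction terms both integrate to `(1 - α) Q(α)` over `[0,1]` and cancel.
  have hpt : ∀ u, (1 - α) * Q α + max (Q u - Q α) 0
      = (Iic u).indicator (fun _ => Q u) α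
        + ((1 - α) * Q α - (Ici α).indicator (fun _ => Q α) u) := by
    intro u
    by_cases h : α ≤ u
    · rw [indicator_of_mem (mem_Iic.2 h), indicator_of_mem (mem_Ici.2 h),
        max_eq_left (sub_nonneg.2 (hQ h))]
      ring
    · rw [indicator_of_notMem (by simpa using h), indicator_of_notMem (by simpa using h),
        max_eq_right (sub_nonpos.2 (hQ (not_le.1 h).le))]
      ring
  have hi1 : Integrable (fun u => (Iic u).indicator (fun _ => Q u) α)
      (volume.restrict (Icc (0 : ℝ) 1)) := by
    have heq : (fun u => (Iic u).indicator (fun _ => Q u) α) = (Ici α).indicator Q := by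
      ext u
      simp [indicator]
    rw [heq]
    exact (Integrable.of_bound (C := M) (by fun_prop) (Eventually.of_forall hM)).indicator
      measurableSet_Ici
  have hi2 : Integrable ((Ici α).indicator fun _ => Q α) (volume.restrict (Icc (0 : ℝ) 1)) :=
    (integrable_const _).indicator measurableSet_Ici
  have hvol : (volume.restrict (Icc (0 : ℝ) 1)).real (Ici α) = 1 - α := by
    have : Ici α ∩ Icc (0 : ℝ) 1 = Icc α 1 := by
      ext u
      exact ⟨fun h => ⟨h.1, h.2.2⟩, fun h => ⟨h.1, hα.1.trans h.1, h.2⟩⟩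
    rw [measureReal_restrict_apply measurableSet_Ici, this, Real.volume_real_Icc_of_le hα.2.le]
  simp only [hpt]
  have hi3 : Integrable (fun u => (1 - α) * Q α - (Ici α).indicator (fun _ => Q α) u)
      (volume.restrict (Icc (0 : ℝ) 1)) := (integrable_const _).sub hi2
  rw [integral_add hi1 hi3, integral_sub (integrable_const _) hi2,
    integral_indicator_const _ measurableSet_Ici, hvol, integral_const]
  simp

end CallMixture

/-! ### The Lebesgue–Stieltjes measure of a distortion -/

section Stieltjes

variable (σ : Distortion)

theorem Distortion.extend_eq {u : ℝ} (hu : u ∈ Icc (0 : ℝ) 1) : σ.extend u = σ u := by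
  rw [extend, min_eq_right hu.2, max_eq_right hu.1]

theorem Distortion.extend_of_nonpos {u : ℝ} (hu : u ≤ 0) : σ.extend u = σ 0 := by
  rw [extend, min_eq_right (hu.trans zero_le_one), max_eq_left hu]

theorem Distortion.tendsto_stieltjesFunction_atBot :
    Tendsto σ.monotone_extend.stieltjesFunction atBot (𝓝 (σ 0)) := by
  refine tendsto_const_nhds.congr' ?_
  filter_upwards [Iio_mem_atBot 0] with x hx
  rw [Monotone.stieltjesFunction_eq]
  refine le_antisymm ?_ ?_
  · rw [← σ.extend_of_nonpos (le_of_lt hx)]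
    exact σ.monotone_extend.le_rightLim le_rfl
  · rw [← σ.extend_of_nonpos le_rfl]
    exact σ.monotone_extend.rightLim_le hx

theorem Distortion.le_stieltjesMeasure_Iic {u : ℝ} (hu : u ∈ Icc (0 : ℝ) 1) :
    ENNReal.ofReal (σ u - σ 0) ≤ σ.stieltjesMeasure (Iic u) := by
  rw [stieltjesMeasure, StieltjesFunction.measure_Iic _ σ.tendsto_stieltjesFunction_atBot,
    Monotone.stieltjesFunction_eq, ← σ.extend_eq hu]
  gcongr
  exact σ.monotone_extend.le_rightLim le_rfl

theorem Distortion.stieltjesMeasure_Iio_le {u : ℝ} (hu : u ∈ Icc (0 : ℝ) 1) :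
    σ.stieltjesMeasure (Iio u) ≤ ENNReal.ofReal (σ u - σ 0) := by
  rw [stieltjesMeasure, StieltjesFunction.measure_Iio _ σ.tendsto_stieltjesFunction_atBot,
    ← σ.extend_eq hu]
  gcongr
  refine le_of_tendsto ((StieltjesFunction.mono _).tendsto_leftLim u) ?_
  filter_upwards [self_mem_nhdsWithin] with v hv
  rw [Monotone.stieltjesFunction_eq]
  exact σ.monotone_extend.rightLim_le hv

/-- The measure `σ(0) δ₀ + dσ` on `[0,1)`; its distribution function there is `σ` up to the values
at the jumps. -/
noncomputable def Distortion.jumpMeasure : Measure ℝ :=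
  ENNReal.ofReal (σ 0) • Measure.dirac 0 + σ.stieltjesMeasure.restrict (Iio 1)

theorem Distortion.mu_eq_withDensity :
    σ.mu = σ.jumpMeasure.withDensity fun α => ENNReal.ofReal (1 - α) := by
  -- The density vanishes on `[1,∞)`, so nothing is lost by dropping the atom of `dσ` at `1`.
  have hind : (Iio (1 : ℝ)).indicator (fun α => ENNReal.ofReal (1 - α))
      = fun α => ENNReal.ofReal (1 - α) := by
    refine indicator_eq_self.2 fun α hα => ?_
    by_contra h
    exact hα (ENNReal.ofReal_of_nonpos (sub_nonpos.2 (not_lt.1 h)))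
  rw [mu, jumpMeasure, withDensity_add_measure, withDensity_smul_measure, dirac_withDensity,
    ← withDensity_indicator measurableSet_Iio, hind]
  simp

theorem Distortion.jumpMeasure_Iio_le {u : ℝ} (hu : u ∈ Icc (0 : ℝ) 1) :
    σ.jumpMeasure (Iio u) ≤ ENNReal.ofReal (σ u) := by
  have h0 : 0 ≤ σ 0 := σ.nonneg 0 (left_mem_Icc.2 zero_le_one)
  have hle : σ 0 ≤ σ u := σ.monotoneOn (left_mem_Icc.2 zero_le_one) hu hu.1
  calc σ.jumpMeasure (Iio u)
      ≤ ENNReal.ofReal (σ 0) * 1 + σ.stieltjesMeasure (Iio u) := by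
        rw [jumpMeasure, Measure.add_apply, Measure.smul_apply, smul_eq_mul]
        gcongr
        · exact prob_le_one
        · exact Measure.restrict_le_self
    _ ≤ ENNReal.ofReal (σ 0) + ENNReal.ofReal (σ u - σ 0) := by
        rw [mul_one]
        gcongr
        exact σ.stieltjesMeasure_Iio_le hu
    _ = ENNReal.ofReal (σ u) := by
        rw [← ENNReal.ofReal_add h0 (sub_nonneg.2 hle), add_sub_cancel]

theorem Distortion.le_jumpMeasure_Iic {u : ℝ} (hu : u ∈ Ico (0 : ℝ) 1) :
    ENNReal.ofReal (σ u) ≤ σ.jumpMeasure (Iic u) := by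
  have hu' := Ico_subset_Icc_self hu
  have h0 : 0 ≤ σ 0 := σ.nonneg 0 (left_mem_Icc.2 zero_le_one)
  have hle : σ 0 ≤ σ u := σ.monotoneOn (left_mem_Icc.2 zero_le_one) hu' hu.1
  rw [jumpMeasure, Measure.add_apply, Measure.smul_apply, smul_eq_mul,
    Measure.dirac_apply_of_mem (mem_Iic.2 hu.1), mul_one,
    Measure.restrict_eq_self _ (Iic_subset_Iio.2 hu.2)]
  calc ENNReal.ofReal (σ u) = ENNReal.ofReal (σ 0) + ENNReal.ofReal (σ u - σ 0) := by
        rw [← ENNReal.ofReal_add h0 (sub_nonneg.2 hle), add_sub_cancel]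
    _ ≤ _ := by
        gcongr
        exact σ.le_stieltjesMeasure_Iic hu'

instance Distortion.isFiniteMeasure_jumpMeasure : IsFiniteMeasure σ.jumpMeasure := by
  have : IsFiniteMeasure (σ.stieltjesMeasure.restrict (Iio 1)) := by
    refine ⟨?_⟩
    rw [Measure.restrict_apply_univ]
    exact (σ.stieltjesMeasure_Iio_le (right_mem_Icc.2 zero_le_one)).trans_lt ENNReal.ofReal_lt_top
  have : IsFiniteMeasure (ENNReal.ofReal (σ 0) • Measure.dirac (0 : ℝ)) :=
    Measure.smul_finite _ ENNReal.ofReal_ne_top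
  unfold jumpMeasure
  infer_instance

theorem Distortion.ae_jumpMeasure_mem : ∀ᵐ α ∂σ.jumpMeasure, α ∈ Ico (0 : ℝ) 1 := by
  have hneg : σ.stieltjesMeasure (Iio 0) = 0 := by
    have := σ.stieltjesMeasure_Iio_le (left_mem_Icc.2 zero_le_one)
    rwa [sub_self, ENNReal.ofReal_zero, nonpos_iff_eq_zero] at this
  refine ae_add_measure_iff.2 ⟨Measure.ae_smul_measure ?_ _, ?_⟩
  · rw [ae_dirac_eq]
    exact left_mem_Ico.2 zero_lt_one
  · have h1 : ∀ᵐ α ∂σ.stieltjesMeasure.restrict (Iio 1), α ∉ Iio (0 : ℝ) :=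
      ae_restrict_of_ae (measure_eq_zero_iff_ae_notMem.1 hneg)
    filter_upwards [ae_restrict_mem measurableSet_Iio, h1] with α h2 h3
    exact ⟨not_lt.1 h3, h2⟩

theorem Distortion.jumpMeasure_real_Iio_le {u : ℝ} (hu : u ∈ Icc (0 : ℝ) 1) :
    σ.jumpMeasure.real (Iio u) ≤ σ u :=
  ENNReal.toReal_le_of_le_ofReal (σ.nonneg u hu) (σ.jumpMeasure_Iio_le hu)

theorem Distortion.le_jumpMeasure_real_Iic {u : ℝ} (hu : u ∈ Ico (0 : ℝ) 1) :
    σ u ≤ σ.jumpMeasure.real (Iic u) :=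
  (ENNReal.ofReal_le_iff_le_toReal (measure_ne_top _ _)).1 (σ.le_jumpMeasure_Iic hu)

/-- The bounds `ν(-∞,u) ≤ σ(u) ≤ ν(-∞,u]` agree off the countably many atoms of `jumpMeasure`. -/
theorem Distortion.ae_jumpMeasure_real_Iic_eq :
    ∀ᵐ u ∂volume.restrict (Icc (0 : ℝ) 1), σ.jumpMeasure.real (Iic u) = σ u := by
  have hcount : {u : ℝ | 0 < σ.jumpMeasure {u}}.Countable :=
    Measure.countable_meas_pos_of_disjoint_iUnion (fun u => measurableSet_singleton u)
      fun u v huv => disjoint_singleton.2 huv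
  rw [← restrict_Ico_eq_restrict_Icc]
  filter_upwards [ae_restrict_mem measurableSet_Ico,
    ae_restrict_of_ae (measure_eq_zero_iff_ae_notMem.1 (hcount.measure_zero volume))] with u hu hu'
  refine le_antisymm (le_trans ?_ (σ.jumpMeasure_real_Iio_le (Ico_subset_Icc_self hu)))
    (σ.le_jumpMeasure_real_Iic hu)
  have h0 : σ.jumpMeasure.real {u} = 0 := by
    rw [measureReal_def, nonpos_iff_eq_zero.1 (not_lt.1 hu'), ENNReal.toReal_zero]
  rw [← Iio_union_right]
  exact (measureReal_union_le _ _).trans (by rw [h0, add_zero])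

end Stieltjes

/-! ### The optimal function and weak duality -/

section Optimal

variable {Ω : Type*} [MeasurableSpace Ω] {P : Measure Ω} {L : Ω → ℝ} (σ : Distortion)

theorem smul_optimalIntegrand {α : ℝ} (hα : α ∈ Ico (0 : ℝ) 1) (y : ℝ) :
    (ENNReal.ofReal (1 - α)).toReal • optimalIntegrand P L y α
      = (1 - α) * quantileExt P L α + max (y - quantileExt P L α) 0 := by
  have h : 0 < 1 - α := sub_pos.2 hα.2
  rw [ENNReal.toReal_ofReal h.le, quantileExt_eq (Ico_subset_Icc_self hα), optimalIntegrand,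
    smul_eq_mul, mul_add, mul_div_cancel₀ _ h.ne']

theorem optimal_eq_callMixture :
    optimal P σ L = callMixture σ.jumpMeasure (quantileExt P L) := by
  funext y
  rw [optimal, σ.mu_eq_withDensity, integral_withDensity_eq_integral_toReal_smul (by fun_prop)
    (Eventually.of_forall fun _ => ENNReal.ofReal_lt_top), callMixture]
  refine integral_congr_ae ?_
  filter_upwards [σ.ae_jumpMeasure_mem] with α hα
  exact smul_optimalIntegrand hα y

theorem integrable_optimalIntegrand [IsProbabilityMeasure P] (hL : MemLp L ⊤ P) (y : ℝ) :
    Integrable (optimalIntegrand P L y) σ.mu := by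
  obtain ⟨M, hM⟩ := exists_ae_abs_le hL
  rw [σ.mu_eq_withDensity, integrable_withDensity_iff_integrable_smul' (by fun_prop)
    (Eventually.of_forall fun _ => ENNReal.ofReal_lt_top)]
  refine (integrable_callMixture σ.ae_jumpMeasure_mem (monotone_quantileExt hL)
    (abs_quantileExt_le hM) y).congr ?_
  filter_upwards [σ.ae_jumpMeasure_mem] with α hα
  exact (smul_optimalIntegrand hα y).symm

theorem convexOn_optimal [IsProbabilityMeasure P] (hL : MemLp L ⊤ P) :
    ConvexOn ℝ univ (optimal P σ L) := by
  obtain ⟨M, hM⟩ := exists_ae_abs_le hL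
  rw [optimal_eq_callMixture]
  exact convexOn_callMixture σ.ae_jumpMeasure_mem (monotone_quantileExt hL) (abs_quantileExt_le hM)

theorem measurable_optimal [IsProbabilityMeasure P] (hL : MemLp L ⊤ P) :
    Measurable (optimal P σ L) := by
  obtain ⟨M, hM⟩ := exists_ae_abs_le hL
  rw [optimal_eq_callMixture]
  exact (monotone_callMixture σ.ae_jumpMeasure_mem (monotone_quantileExt hL)
    (abs_quantileExt_le hM)).measurable

theorem integrable_quantileExt_mul [IsProbabilityMeasure P] (hL : MemLp L ⊤ P) :
    Integrable (fun u => quantileExt P L u * σ u) (volume.restrict (Icc (0 : ℝ) 1)) := by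
  obtain ⟨M, hM⟩ := exists_ae_abs_le hL
  have hQ := (monotone_quantileExt hL).measurable
  have hF : Measurable fun u => σ.jumpMeasure.real (Iic u) :=
    Monotone.measurable fun u v huv => measureReal_mono (Iic_subset_Iic.2 huv)
  have hi : Integrable (fun u => quantileExt P L u * σ.jumpMeasure.real (Iic u))
      (volume.restrict (Icc (0 : ℝ) 1)) := by
    refine Integrable.of_bound (C := M * σ.jumpMeasure.real univ) (by fun_prop)
      (Eventually.of_forall fun u => ?_)
    rw [norm_mul, Real.norm_eq_abs, Real.norm_of_nonneg measureReal_nonneg]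
    have := abs_quantileExt_le hM u
    exact mul_le_mul this (measureReal_mono (subset_univ _)) measureReal_nonneg
      ((abs_nonneg _).trans this)
  refine hi.congr ?_
  filter_upwards [σ.ae_jumpMeasure_real_Iic_eq] with u hu
  rw [hu]

theorem quantileExt_mul_ae_eq : (fun u => quantileExt P L u * σ u)
    =ᵐ[volume.restrict (Icc (0 : ℝ) 1)] fun u => quantile P L u * σ u := by
  filter_upwards [ae_restrict_mem measurableSet_Icc] with u hu
  rw [quantileExt_eq hu]

theorem premium_eq : premium P σ L = ∫ u in Icc (0 : ℝ) 1, quantileExt P L u * σ u := by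
  rw [premium, intervalIntegral.integral_of_le zero_le_one, restrict_Ioc_eq_restrict_Icc,
    integral_congr_ae (quantileExt_mul_ae_eq σ)]

theorem intervalIntegrable_quantile_mul [IsProbabilityMeasure P] (hL : MemLp L ⊤ P) :
    IntervalIntegrable (fun u => quantile P L u * σ u) volume 0 1 := by
  rw [intervalIntegrable_iff_integrableOn_Icc_of_le zero_le_one]
  exact (integrable_quantileExt_mul σ hL).congr (quantileExt_mul_ae_eq σ)

theorem integrable_optimal_quantileExt [IsProbabilityMeasure P] (hL : MemLp L ⊤ P) :
    Integrable (fun u => optimal P σ L (quantileExt P L u)) (volume.restrict (Icc (0 : ℝ) 1)) := by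
  obtain ⟨M, hM⟩ := exists_ae_abs_le hL
  rw [optimal_eq_callMixture]
  exact integrable_callMixture_comp σ.ae_jumpMeasure_mem (monotone_quantileExt hL)
    (abs_quantileExt_le hM)

theorem integral_optimal_quantileExt [IsProbabilityMeasure P] (hL : MemLp L ⊤ P) :
    ∫ u in Icc (0 : ℝ) 1, optimal P σ L (quantileExt P L u) = premium P σ L := by
  obtain ⟨M, hM⟩ := exists_ae_abs_le hL
  rw [optimal_eq_callMixture, premium_eq, integral_callMixture_comp σ.ae_jumpMeasure_mem
    (monotone_quantileExt hL) (abs_quantileExt_le hM)]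
  refine integral_congr_ae ?_
  filter_upwards [σ.ae_jumpMeasure_real_Iic_eq] with u hu
  rw [hu]

theorem integrable_optimal [IsProbabilityMeasure P] (hL : MemLp L ⊤ P) :
    Integrable (fun ω => optimal P σ L (L ω)) P := by
  have h := (integrable_map_measure (measurable_optimal σ hL).aestronglyMeasurable
    (monotone_quantileExt hL).measurable.aemeasurable).2 (integrable_optimal_quantileExt σ hL)
  rw [map_quantileExt hL] at h
  exact (integrable_map_measure (measurable_optimal σ hL).aestronglyMeasurable hL.1.aemeasurable).1 h

theorem integral_optimal [IsProbabilityMeasure P] (hL : MemLp L ⊤ P) :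
    ∫ ω, optimal P σ L (L ω) ∂P = premium P σ L := by
  rw [← integral_optimal_quantileExt σ hL,
    ← integral_map hL.1.aemeasurable (measurable_optimal σ hL).aestronglyMeasurable,
    ← map_quantileExt hL, integral_map (monotone_quantileExt hL).measurable.aemeasurable
    (measurable_optimal σ hL).aestronglyMeasurable]

/-- For `u < 1` the supremum in `h_σ*(σ(u))` is attained at the quantile `F_L⁻¹(u)`. At `u = 1` the
conjugate may be `+∞`, namely if `σ` jumps there. -/
theorem conjugate_optimal [IsProbabilityMeasure P] (hL : MemLp L ⊤ P) {u : ℝ}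
    (hu : u ∈ Ico (0 : ℝ) 1) : conjugate (optimal P σ L) (σ u)
      = ((quantileExt P L u * σ u - optimal P σ L (quantileExt P L u) : ℝ) : EReal) := by
  obtain ⟨M, hM⟩ := exists_ae_abs_le hL
  refine conjugate_eq_of_subgradient fun x => ?_
  rw [optimal_eq_callMixture]
  exact callMixture_add_le σ.ae_jumpMeasure_mem (monotone_quantileExt hL) (abs_quantileExt_le hM)
    (σ.jumpMeasure_real_Iio_le (Ico_subset_Icc_self hu)) (σ.le_jumpMeasure_real_Iic hu) x

theorem conjugateTerm_optimal [IsProbabilityMeasure P] (hL : MemLp L ⊤ P) :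
    conjugateTerm σ (optimal P σ L) = 0 := by
  have hae : (fun u => conjugate (optimal P σ L) (σ u)) =ᵐ[volume.restrict (Icc (0 : ℝ) 1)]
      fun u => ((quantileExt P L u * σ u - optimal P σ L (quantileExt P L u) : ℝ) : EReal) := by
    rw [← restrict_Ico_eq_restrict_Icc]
    filter_upwards [ae_restrict_mem measurableSet_Ico] with u hu
    exact conjugate_optimal σ hL hu
  have h1 := integrable_quantileExt_mul σ hL
  have h2 := integrable_optimal_quantileExt σ hL
  have h3 : Integrable (fun u => quantileExt P L u * σ u - optimal P σ L (quantileExt P L u))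
      (volume.restrict (Icc (0 : ℝ) 1)) := h1.sub h2
  rw [conjugateTerm, extIntegral_congr hae, extIntegral_coe h3, integral_sub h1 h2,
    integral_optimal_quantileExt σ hL, ← premium_eq, sub_self, EReal.coe_zero]

theorem objective_optimal [IsProbabilityMeasure P] (hL : MemLp L ⊤ P) :
    objective P σ L (optimal P σ L) = ((premium P σ L : ℝ) : EReal) := by
  rw [objective, conjugateTerm_optimal σ hL, expectationTerm,
    extIntegral_coe (integrable_optimal σ hL), integral_optimal σ hL, if_neg (by simp), add_zero]

/-- `E h(L)` only depends on the law of `L`, so it may be computed along the quantile function. -/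
theorem expectationTerm_eq [IsProbabilityMeasure P] (hL : MemLp L ⊤ P) {h : ℝ → ℝ}
    (hh : Measurable h) : expectationTerm P L h
      = extIntegral (volume.restrict (Icc (0 : ℝ) 1))
        (fun u => ((h (quantileExt P L u) : ℝ) : EReal)) := by
  have key : ∀ g : ℝ → ENNReal, Measurable g →
      ∫⁻ ω, g (L ω) ∂P = ∫⁻ u in Icc (0 : ℝ) 1, g (quantileExt P L u) := fun g hg => by
    rw [← lintegral_map (μ := volume.restrict _) hg (monotone_quantileExt hL).measurable,
      map_quantileExt hL, lintegral_map' hg.aemeasurable hL.1.aemeasurable]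
  unfold expectationTerm extIntegral
  rw [key (fun x => ((h x : ℝ) : EReal).toENNReal) (by fun_prop),
    key (fun x => (-((h x : ℝ) : EReal)).toENNReal) (by fun_prop)]

/-- Weak duality: Young's inequality `F_L⁻¹(u) σ(u) ≤ h(F_L⁻¹(u)) + h*(σ(u))`, integrated. -/
theorem premium_le_objective [IsProbabilityMeasure P] (hL : MemLp L ⊤ P) {h : ℝ → ℝ}
    (hh : Measurable h) : ((premium P σ L : ℝ) : EReal) ≤ objective P σ L h := by
  unfold objective
  split_ifs with htop
  · exact le_top
  push Not at htop
  have hσ : AEMeasurable σ.toFun (volume.restrict (Icc (0 : ℝ) 1)) :=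
    aemeasurable_restrict_of_monotoneOn measurableSet_Icc σ.monotoneOn
  rw [expectationTerm_eq hL hh, conjugateTerm] at *
  rw [premium_eq]
  exact integral_le_extIntegral_add (integrable_quantileExt_mul σ hL)
    (hh.comp (monotone_quantileExt hL).measurable).aemeasurable
    ((measurable_conjugate h).comp_aemeasurable hσ) (fun _ => conjugate_ne_bot _ _)
    htop.1 htop.2 (Eventually.of_forall fun _ => coe_mul_le_add_conjugate h _ _)

end Optimal

end DistortedPremium

theorem mainTheorem2 {Ω : Type*} [MeasurableSpace Ω] (P : Measure Ω) [IsProbabilityMeasure P]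
    (L : Ω → ℝ) (hL : MemLp L ⊤ P) (σ : DistortedPremium.Distortion) :
    -- the premium is a convergent integral, and it is the infimum
    IntervalIntegrable (fun u => DistortedPremium.quantile P L u * σ u) volume 0 1 ∧
    ((DistortedPremium.premium P σ L : ℝ) : EReal) =
      (⨅ h : {h : ℝ → ℝ // Measurable h}, DistortedPremium.objective P σ L h.1) ∧
    -- the function `h_σ` is well defined, admissible and convex
    (∀ y : ℝ, Integrable (DistortedPremium.optimalIntegrand P L y) σ.mu) ∧
    Measurable (DistortedPremium.optimal P σ L) ∧
    ConvexOn ℝ Set.univ (DistortedPremium.optimal P σ L) ∧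
    -- it attains the infimum, with these values of the two terms
    Integrable (fun ω => DistortedPremium.optimal P σ L (L ω)) P ∧
    ∫ ω, DistortedPremium.optimal P σ L (L ω) ∂P = DistortedPremium.premium P σ L ∧
    DistortedPremium.conjugateTerm σ (DistortedPremium.optimal P σ L) = 0 ∧
    DistortedPremium.objective P σ L (DistortedPremium.optimal P σ L) =
      ((DistortedPremium.premium P σ L : ℝ) : EReal) := by
  refine ⟨DistortedPremium.intervalIntegrable_quantile_mul σ hL, le_antisymm ?_ ?_,
    DistortedPremium.integrable_optimalIntegrand σ hL, DistortedPremium.measurable_optimal σ hL,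
    DistortedPremium.convexOn_optimal σ hL, DistortedPremium.integrable_optimal σ hL,
    DistortedPremium.integral_optimal σ hL, DistortedPremium.conjugateTerm_optimal σ hL,
    DistortedPremium.objective_optimal σ hL⟩
  · exact le_iInf fun h => DistortedPremium.premium_le_objective σ hL h.2
  · rw [← DistortedPremium.objective_optimal σ hL]
    exact iInf_le (fun h : {h : ℝ → ℝ // Measurable h} => DistortedPremium.objective P σ L h.1)
      ⟨_, DistortedPremium.measurable_optimal σ hL⟩
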